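/- Let $k$ be an arbitrary field, let $n\ge 0$, and let $I\subseteq k[x_0,\dots,x_n]$ be a homogeneous ideal (for the standard grading) of projective dimension $d\ge 0$, i.e. such that the quotient ring $k[x_0,\dots,x_n]/I$ has Krull dimension $d+1$. Let $$h_I(m)=\dim_k\bigl(k[x_0,\dots,x_n]/I\bigr)_m$$ be the Hilbert function of $I$. Then there is a unique polynomial $p_I\in\mathbb{Q}[t]$ with $h_I(m)=p_I(m)$ for all sufficiently large integers $m$ (the Hilbert polynomial of $I$); it has degree exactly $d$, and, writing $a_d$ for its leading coefficient, $\deg I:=d!\,a_d$ is a natural number. Moreover $$h_I(m)\ \ge\ \binom{m+d+1}{d+1}-\binom{m-\deg I+d+1}{d+1}\qquad\text{for all integers } m\ge 1,$$ where $\binom{a}{b}:=0$ whenever $a<b$, in particular for negative $a$. -/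

import Mathlib

open Polynomial

attribute [local instance] MvPolynomial.gradedAlgebra

noncomputable section

namespace HilbertBound

/-- The Hilbert function `h_I(m) = dim_k (k[x_0,…,x_n]/I)_m`. The homogeneous part of degree `m`
of the quotient is the image of the space of forms of degree `m`. -/
def hilbertFunction {k : Type*} [Field k] {n : ℕ}
    (I : Ideal (MvPolynomial (Fin (n + 1)) k)) (m : ℕ) : ℕ :=
  Module.finrank k
    ((MvPolynomial.homogeneousSubmodule (Fin (n + 1)) k m).map
      (Ideal.Quotient.mkₐ k I).toLinearMap)

/-- `I` has (projective) dimension `d ≥ 0`, i.e. `dim_krull (k[x_0,…,x_n]/I) - 1 = d`. -/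
def HasProjDim {k : Type*} [Field k] {n : ℕ}
    (I : Ideal (MvPolynomial (Fin (n + 1)) k)) (d : ℕ) : Prop :=
  ringKrullDim (MvPolynomial (Fin (n + 1)) k ⧸ I) = (d : WithBot ℕ∞) + 1

/-- `p` agrees with the Hilbert function of `I` at all large integers. There is at most
one such `p`. -/
def IsHilbertPolynomial {k : Type*} [Field k] {n : ℕ}
    (I : Ideal (MvPolynomial (Fin (n + 1)) k)) (p : ℚ[X]) : Prop :=
  ∃ m₀ : ℕ, ∀ m : ℕ, m₀ ≤ m → (hilbertFunction I m : ℚ) = p.eval (m : ℚ)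

open Classical in
/-- The Hilbert polynomial `p_I ∈ ℚ[t]` (with value `0` if there were none). -/
def hilbertPolynomial {k : Type*} [Field k] {n : ℕ}
    (I : Ideal (MvPolynomial (Fin (n + 1)) k)) : ℚ[X] :=
  if h : ∃ p : ℚ[X], IsHilbertPolynomial I p then h.choose else 0

/-- The degree `d! * a_d` of an ideal `I` of projective dimension `d ≥ 0`, where `a_d` is the
coefficient of `t^d` in the Hilbert polynomial of `I`. -/
def idealDegree {k : Type*} [Field k] {n : ℕ}
    (I : Ideal (MvPolynomial (Fin (n + 1)) k)) (d : ℕ) : ℚ :=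
  (d.factorial : ℚ) * (hilbertPolynomial I).coeff d

/-- The binomial coefficient of an integer `a` over `b`, which is `0` for negative `a`. -/
def binom (a : ℤ) (b : ℕ) : ℤ :=
  if 0 ≤ a then (a.toNat.choose b : ℤ) else 0

end HilbertBound

end

/-
The initial ideal with respect to a monomial order has the same Hilbert function as `I`, so that
`h_I(m)` counts the standard exponents of degree `m`. They form a lower set, which is the disjoint
union of finitely many cones `v + ℕ^Z`, because by Dickson's lemma membership only depends on the
truncation of an exponent at some bound `c`. Counting the cones, `h_I` is a polynomial for large
`m` whose degree is one less than the largest dimension of a cone, and `deg I` is the number `δ`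
of cones of that dimension. This dimension is the Krull dimension of the quotient: the variables in
a cone are algebraically independent, and conversely `r` algebraically independent elements force
growth of order at least `t ^ r`.

For the lower bound, replace each top-dimensional cone `v + ℕ^Z` by the larger one whose vertex
vanishes on `Z`; the vertices belonging to a fixed `Z` then form a lower set. The `δ` enlarged cones
may overlap. Treat them one at a time, smaller vertices first: the degree of a vertex is at most the
number of earlier cones with the same `Z`, and one step for each of the other earlier cones makes
its cone disjoint from all of them. This yields disjoint cones with vertices of degree at most
`0, …, δ - 1`. The numbers of elements of degree `m` in these cones sum to at least the
difference of binomial coefficients.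
-/

namespace HilbertBound

open Finset

section Binom

lemma binom_natCast (a b : ℕ) : binom a b = a.choose b := by
  simp [binom]

lemma binom_eq_zero_of_lt {a : ℤ} {b : ℕ} (h : a < b) : binom a b = 0 := by
  unfold binom
  split_ifs with ha
  · exact_mod_cast Nat.choose_eq_zero_of_lt (by omega)
  · rfl

lemma binom_mono (b : ℕ) : Monotone (binom · b) := by
  intro x y hxy
  by_cases hx : 0 ≤ x
  · lift x to ℕ using hx
    lift y to ℕ using by omega
    simpa only [binom_natCast] using mod_cast Nat.choose_le_choose b (mod_cast hxy)
  · simp only [binom, hx, if_false]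
    split_ifs <;> positivity

lemma binom_add_one_add_one (a : ℤ) (b : ℕ) :
    binom (a + 1) (b + 1) = binom a b + binom a (b + 1) := by
  by_cases ha : 0 ≤ a
  · lift a to ℕ using ha
    rw [← Nat.cast_succ]
    simpa only [binom_natCast] using mod_cast Nat.choose_succ_succ a b
  · rw [binom_eq_zero_of_lt (by omega), binom_eq_zero_of_lt (by omega),
      binom_eq_zero_of_lt (by omega), add_zero]

lemma sum_range_binom (a : ℤ) (b r : ℕ) :
    ∑ j ∈ range r, binom (a - j) b = binom (a + 1) (b + 1) - binom (a + 1 - r) (b + 1) := by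
  induction r with
  | zero => simp
  | succ r ih =>
    have pascal := binom_add_one_add_one (a - r) b
    rw [sub_add_eq_add_sub] at pascal
    rw [sum_range_succ, ih, pascal, Nat.cast_succ, add_sub_add_right_eq_sub]
    ring

end Binom

noncomputable section Cone

variable {σ : Type*}

/-- The translate `g + ℕ^Z` of the coordinate cone spanned by the directions in `Z`. -/
def cone (g : σ →₀ ℕ) (Z : Finset σ) : Set (σ →₀ ℕ) :=
  {u | g ≤ u ∧ ∀ i ∉ Z, u i = g i}

lemma cone_subset_cone {g h : σ →₀ ℕ} {Z : Finset σ} (hg : g ∈ cone h Z) :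
    cone g Z ⊆ cone h Z :=
  fun _ hu => ⟨hg.1.trans hu.1, fun i hi => (hu.2 i hi).trans (hg.2 i hi)⟩

lemma mem_cone_iff_exists_add {g u : σ →₀ ℕ} {Z : Finset σ} :
    u ∈ cone g Z ↔ ∃ w : σ →₀ ℕ, w.support ⊆ Z ∧ g + w = u := by
  constructor
  · rintro ⟨hgu, hu⟩
    refine ⟨u - g, fun i hi => ?_, add_tsub_cancel_of_le hgu⟩
    by_contra hiZ
    simp [hu i hiZ] at hi
  · rintro ⟨w, hw, rfl⟩
    refine ⟨le_self_add, fun i hi => ?_⟩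
    simp [Finsupp.notMem_support_iff.1 fun h => hi (hw h)]

/-- The number of elements of degree `m` in a set of exponents; it is meant for finite `σ`, where
there are only finitely many exponents of each degree. -/
def levelCard (S : Set (σ →₀ ℕ)) (m : ℕ) : ℕ :=
  (S ∩ Finsupp.degree ⁻¹' {m}).ncard

lemma finite_inter_degree_preimage_singleton [Finite σ] (S : Set (σ →₀ ℕ)) (m : ℕ) :
    (S ∩ Finsupp.degree ⁻¹' {m}).Finite :=
  (Finsupp.finite_of_degree_le m).subset fun _ hu => hu.2.le

lemma levelCard_mono [Finite σ] {S T : Set (σ →₀ ℕ)} (h : S ⊆ T) (m : ℕ) :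
    levelCard S m ≤ levelCard T m :=
  Set.ncard_le_ncard (Set.inter_subset_inter_left _ h)
    (finite_inter_degree_preimage_singleton T m)

lemma levelCard_union [Finite σ] {S T : Set (σ →₀ ℕ)} (h : Disjoint S T) (m : ℕ) :
    levelCard (S ∪ T) m = levelCard S m + levelCard T m := by
  rw [levelCard, Set.union_inter_distrib_right]
  exact Set.ncard_union_eq (h.mono Set.inter_subset_left Set.inter_subset_left)
    (finite_inter_degree_preimage_singleton S m) (finite_inter_degree_preimage_singleton T m)

lemma cone_inter_degree_eq_image [DecidableEq σ] (g : σ →₀ ℕ) (Z : Finset σ) (r : ℕ) :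
    cone g Z ∩ Finsupp.degree ⁻¹' {g.degree + r} = (g + ·) '' ↑(Z.finsuppAntidiag r) := by
  have degree_add : ∀ w, (g + w).degree = g.degree + r ↔ w.degree = r := by simp
  ext u
  simp only [Set.mem_inter_iff, mem_cone_iff_exists_add, Set.mem_preimage, Set.mem_singleton_iff,
    Set.mem_image, mem_coe, mem_finsuppAntidiag']
  constructor
  · rintro ⟨⟨w, hw, rfl⟩, hu⟩
    exact ⟨w, ⟨(degree_add w).1 hu, hw⟩, rfl⟩
  · rintro ⟨w, ⟨hr, hw⟩, rfl⟩
    exact ⟨⟨w, hw, rfl⟩, (degree_add w).2 hr⟩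

lemma levelCard_cone_degree_add (g : σ →₀ ℕ) (Z : Finset σ) (r : ℕ) :
    levelCard (cone g Z) (g.degree + r) = (#Z + r - 1).choose r := by
  classical
  rw [levelCard, cone_inter_degree_eq_image,
    Set.ncard_image_of_injective _ (add_right_injective g), Set.ncard_coe_finset,
    card_finsuppAntidiag_nat_eq_choose]

lemma levelCard_cone_of_lt_degree {g : σ →₀ ℕ} (Z : Finset σ) {m : ℕ} (hm : m < g.degree) :
    levelCard (cone g Z) m = 0 := by
  have hempty : cone g Z ∩ Finsupp.degree ⁻¹' {m} = ∅ :=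
    Set.eq_empty_of_forall_notMem fun u ⟨hu, hum⟩ =>
      (hm.trans_le (Finsupp.degree_mono hu.1)).ne' hum
  rw [levelCard, hempty, Set.ncard_empty]

lemma levelCard_cone_of_card_eq_succ (g : σ →₀ ℕ) {Z : Finset σ} {D : ℕ} (hZ : #Z = D + 1)
    (m : ℕ) : (levelCard (cone g Z) m : ℤ) = binom (m + D - g.degree) D := by
  obtain hm | ⟨r, rfl⟩ := (lt_or_ge m g.degree).imp_right Nat.exists_eq_add_of_le
  · rw [levelCard_cone_of_lt_degree Z hm, binom_eq_zero_of_lt (by omega), Nat.cast_zero]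
  · rw [levelCard_cone_degree_add, hZ,
      show ((g.degree + r : ℕ) : ℤ) + D - g.degree = (r + D : ℕ) by push_cast; ring,
      binom_natCast, show D + 1 + r - 1 = r + D by omega, Nat.choose_symm_add]

lemma levelCard_cone_empty {g : σ →₀ ℕ} {m : ℕ} (hm : g.degree < m) :
    levelCard (cone g ∅) m = 0 := by
  obtain ⟨r, rfl⟩ := Nat.exists_eq_add_of_lt hm
  rw [add_assoc, levelCard_cone_degree_add]
  exact Nat.choose_eq_zero_of_lt (by simp)

end Cone

section DisjointCones

variable {σ : Type*} {D : ℕ}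

lemma degree_lt_card_filter_snd_eq [DecidableEq σ] {s : Finset ((σ →₀ ℕ) × Finset σ)}
    (hs : ∀ Z, IsLowerSet {a | (a, Z) ∈ s}) {p : (σ →₀ ℕ) × Finset σ} (hp : p ∈ s) :
    p.1.degree < #{q ∈ s | q.2 = p.2} := by
  have hsub : range (p.1.degree + 1) ⊆ {q ∈ s | q.2 = p.2}.image (·.1.degree) := fun t ht => by
    obtain ⟨b, hb, rfl⟩ :=
      Finsupp.exists_le_degree_eq p.1 t (Nat.lt_succ_iff.1 (mem_range.1 ht))
    exact mem_image.2 ⟨(b, p.2), mem_filter.2 ⟨hs p.2 hb hp, rfl⟩, rfl⟩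
  simpa using (card_le_card hsub).trans card_image_le

lemma exists_shift [DecidableEq σ] {s : Finset ((σ →₀ ℕ) × Finset σ)} {Z : Finset σ}
    (hcard : ∀ p ∈ s, #p.2 = #Z) :
    ∃ w : σ →₀ ℕ, w.support ⊆ Z ∧ w.degree = #{q ∈ s | q.2 ≠ Z} ∧
      ∀ p ∈ s, p.2 ≠ Z → ∃ i ∉ p.2, #{q ∈ s | q.2 = p.2} ≤ w i := by
  have exists_direction : ∀ Y : Finset σ, #Y = #Z → Y ≠ Z →
      ∃ e : σ →₀ ℕ, ∃ i ∈ Z, i ∉ Y ∧ e = Finsupp.single i 1 := fun Y hY hYZ => by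
    obtain ⟨i, hiZ, hiY⟩ := not_subset.1 fun h => hYZ (eq_of_subset_of_card_le h hY.le).symm
    exact ⟨_, i, hiZ, hiY, rfl⟩
  choose! e he using exists_direction
  -- For each cone with another set of directions, take one step in a direction leaving it.
  refine ⟨∑ q ∈ s with q.2 ≠ Z, e q.2, fun j hj => ?_, ?_, fun p hp hpZ => ?_⟩
  · obtain ⟨q, hq, hjq⟩ := mem_biUnion.1 (Finsupp.support_finsetSum hj)
    rw [mem_filter] at hq
    obtain ⟨i, hiZ, -, hei⟩ := he q.2 (hcard q hq.1) hq.2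
    rw [hei] at hjq
    rwa [mem_singleton.1 (Finsupp.support_single_subset hjq)]
  · rw [map_sum, card_eq_sum_ones]
    refine sum_congr rfl fun q hq => ?_
    rw [mem_filter] at hq
    obtain ⟨i, -, -, hei⟩ := he q.2 (hcard q hq.1) hq.2
    rw [hei, Finsupp.degree_single]
  · obtain ⟨i, -, hip, hei⟩ := he p.2 (hcard p hp) hpZ
    refine ⟨i, hip, ?_⟩
    calc #{q ∈ s | q.2 = p.2} = ∑ q ∈ s with q.2 = p.2, e q.2 i := by
          rw [card_eq_sum_ones]
          exact sum_congr rfl fun q hq => by rw [(mem_filter.1 hq).2, hei, Finsupp.single_eq_same]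
      _ ≤ ∑ q ∈ s with q.2 ≠ Z, e q.2 i :=
        sum_le_sum_of_subset (monotone_filter_right s fun q _ hq => by rwa [hq])
      _ = (∑ q ∈ s with q.2 ≠ Z, e q.2) i := (Finsupp.finsetSum_apply _ _ _).symm

lemma exists_cone_subset_disjoint [DecidableEq σ] {s : Finset ((σ →₀ ℕ) × Finset σ)}
    {a : σ →₀ ℕ} {Z : Finset σ} (hcard : ∀ p ∈ s, #p.2 = #Z)
    (hs : ∀ p ∈ s, ∀ i ∈ p.2, p.1 i = 0) (ha : ∀ i ∈ Z, a i = 0)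
    (hdeg : ∀ p ∈ s, p.1.degree < #{q ∈ s | q.2 = p.2}) (haZ : (a, Z) ∉ s) :
    ∃ g ∈ cone a Z, g.degree = a.degree + #{q ∈ s | q.2 ≠ Z} ∧
      ∀ p ∈ s, Disjoint (cone g Z) (cone p.1 p.2) := by
  obtain ⟨w, hwZ, hwdeg, hw⟩ := exists_shift hcard
  have hg : a + w ∈ cone a Z := mem_cone_iff_exists_add.2 ⟨w, hwZ, rfl⟩
  refine ⟨a + w, hg, by rw [map_add, hwdeg], fun p hp =>
    Set.disjoint_left.2 fun u hug hup => ?_⟩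
  by_cases hpZ : p.2 = Z
  · have hpa : p.1 = a := by
      ext i
      by_cases hi : i ∈ Z
      · rw [hs p hp i (hpZ ▸ hi), ha i hi]
      · rw [← hup.2 i (hpZ ▸ hi), hug.2 i hi, hg.2 i hi]
    exact haZ (by rwa [← hpa, ← hpZ])
  · obtain ⟨i, hip, hwi⟩ := hw p hp hpZ
    have hwu : w i ≤ u i := (le_add_self : w ≤ a + w).trans hug.1 i
    exact ((Finsupp.le_degree i p.1).trans_lt (hdeg p hp)).not_ge
      ((hwi.trans hwu).trans_eq (hup.2 i hip))

lemma levelCard_iUnion_cone_insert [DecidableEq σ] [Finite σ] {s : Finset ((σ →₀ ℕ) × Finset σ)}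
    {p : (σ →₀ ℕ) × Finset σ} (hcard : ∀ q ∈ insert p s, #q.2 = D + 1)
    (hzero : ∀ q ∈ insert p s, ∀ i ∈ q.2, q.1 i = 0) (hs : ∀ Z, IsLowerSet {a | (a, Z) ∈ s})
    (hps : ∀ Z, IsLowerSet {a | (a, Z) ∈ insert p s}) (hp : p ∉ s) (m : ℕ) :
    binom (m + D - #s) D + levelCard (⋃ q ∈ s, cone q.1 q.2) m ≤
      levelCard (⋃ q ∈ insert p s, cone q.1 q.2) m := by
  rw [forall_mem_insert] at hcard hzero
  obtain ⟨g, hg, hgdeg, hdisj⟩ := exists_cone_subset_disjoint (fun q hq => by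
    rw [hcard.1, hcard.2 q hq]) hzero.2 hzero.1 (fun q hq => degree_lt_card_filter_snd_eq hs hq) hp
  have hgs : g.degree ≤ #s := by
    have hlt := degree_lt_card_filter_snd_eq hps (mem_insert_self p s)
    rw [filter_insert, if_pos rfl, card_insert_of_notMem (by simp [hp])] at hlt
    rw [hgdeg, ← card_filter_add_card_filter_not (s := s) (·.2 = p.2)]
    exact Nat.add_le_add_right (Nat.lt_succ_iff.1 hlt) _
  calc binom (m + D - #s) D + levelCard (⋃ q ∈ s, cone q.1 q.2) m
      ≤ levelCard (cone g p.2) m + levelCard (⋃ q ∈ s, cone q.1 q.2) m := by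
        rw [levelCard_cone_of_card_eq_succ g hcard.1]
        exact add_le_add_left (binom_mono D (by omega)) _
    _ = levelCard (cone g p.2 ∪ ⋃ q ∈ s, cone q.1 q.2) m := by
        rw [levelCard_union (by simpa only [Set.disjoint_iUnion_right] using hdisj), Nat.cast_add]
    _ ≤ levelCard (⋃ q ∈ insert p s, cone q.1 q.2) m := by
        rw [set_biUnion_insert]
        exact mod_cast levelCard_mono (Set.union_subset_union_left _ (cone_subset_cone hg)) m

lemma sum_range_binom_le_levelCard_iUnion_cone [Finite σ] (s : Finset ((σ →₀ ℕ) × Finset σ))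
    (hcard : ∀ p ∈ s, #p.2 = D + 1) (hzero : ∀ p ∈ s, ∀ i ∈ p.2, p.1 i = 0)
    (hs : ∀ Z, IsLowerSet {a | (a, Z) ∈ s}) (m : ℕ) :
    ∑ j ∈ range #s, binom (m + D - j) D ≤ levelCard (⋃ p ∈ s, cone p.1 p.2) m := by
  classical
  induction s using eraseInduction with
  | H s ih =>
    obtain rfl | hne := s.eq_empty_or_nonempty
    · simp
    obtain ⟨p, hp⟩ := s.exists_maximal hne
    have hs' : ∀ Z, IsLowerSet {a | (a, Z) ∈ s.erase p} := fun Z a b hba ha => by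
      refine mem_erase.2 ⟨fun hb => ?_, hs Z hba (mem_of_mem_erase ha)⟩
      have hpa : p ≤ (a, Z) := hb ▸ Prod.mk_le_mk.2 ⟨hba, le_rfl⟩
      exact ne_of_mem_erase ha (hp.eq_of_le (mem_of_mem_erase ha) hpa).symm
    have hstep := levelCard_iUnion_cone_insert (p := p) (s := s.erase p) (D := D)
    rw [insert_erase hp.prop] at hstep
    rw [← card_erase_add_one hp.prop, sum_range_succ, add_comm]
    exact (add_le_add_right (ih p hp.prop (fun q hq => hcard q (mem_of_mem_erase hq))
      (fun q hq => hzero q (mem_of_mem_erase hq)) hs') _).trans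
      (hstep hcard hzero hs' hs (notMem_erase p s) m)

end DisjointCones

noncomputable section StanleyDecomposition

variable {σ : Type*}

/-- Truncation of all exponents at `c`. -/
def trunc (c : ℕ) (u : σ →₀ ℕ) : σ →₀ ℕ :=
  u.mapRange (min · c) (Nat.zero_min c)

@[simp]
lemma trunc_apply (c : ℕ) (u : σ →₀ ℕ) (i : σ) : trunc c u i = min (u i) c := by
  simp [trunc]

lemma trunc_le (c : ℕ) (u : σ →₀ ℕ) : trunc c u ≤ u :=
  fun i => by simp

/-- Whether an exponent lies in `S` depends only on its truncation at `c`. -/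
def IsTruncStable (S : Set (σ →₀ ℕ)) (c : ℕ) : Prop :=
  ∀ u, u ∈ S ↔ trunc c u ∈ S

lemma exists_isTruncStable [Finite σ] {S : Set (σ →₀ ℕ)} (hS : IsLowerSet S) :
    ∃ c, IsTruncStable S c := by
  -- Dickson's lemma: the complement of `S` has finitely many minimal elements.
  have hfin : {g | Minimal (· ∈ Sᶜ) g}.Finite :=
    WellQuasiOrderedLE.finite_of_isAntichain (setOfPred_minimal_antichain _)
  refine ⟨hfin.toFinset.sup Finsupp.degree, fun u => ⟨fun h => hS (trunc_le _ u) h, fun h => ?_⟩⟩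
  by_contra hu
  obtain ⟨g, hgu, hg⟩ := (Set.isPWO_of_wellQuasiOrderedLE Sᶜ).exists_le_minimal hu
  refine hg.prop (hS (fun i => ?_) h)
  rw [trunc_apply]
  exact le_min (hgu i) ((Finsupp.le_degree i g).trans
    (le_sup (f := Finsupp.degree) (by simpa using hg)))

/-- The exponent `v` with all entries equal to `c` replaced by `0`. -/
def base (c : ℕ) (v : σ →₀ ℕ) : σ →₀ ℕ :=
  v.mapRange (fun x => if x = c then 0 else x) (ite_self 0)

@[simp]
lemma base_apply (c : ℕ) (v : σ →₀ ℕ) (i : σ) : base c v i = if v i = c then 0 else v i := by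
  simp [base]

lemma finite_box [Finite σ] (S : Set (σ →₀ ℕ)) (c : ℕ) :
    {v | v ∈ S ∧ ∀ i, v i ≤ c}.Finite := by
  classical
  exact (Set.finite_Iic (Finsupp.equivFunOnFinite.symm fun _ : σ => c)).subset fun _ hv => hv.2

variable [Fintype σ] {S : Set (σ →₀ ℕ)} {c : ℕ}

/-- The directions in which the exponent `v` has reached the bound `c`. -/
def topFace (c : ℕ) (v : σ →₀ ℕ) : Finset σ := {i | v i = c}

@[simp]
lemma mem_topFace {v : σ →₀ ℕ} {i : σ} : i ∈ topFace c v ↔ v i = c := by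
  simp [topFace]

/-- The elements of `S` with all exponents at most `c`. -/
def box (S : Set (σ →₀ ℕ)) (c : ℕ) : Finset (σ →₀ ℕ) := (finite_box S c).toFinset

@[simp]
lemma mem_box {v : σ →₀ ℕ} : v ∈ box S c ↔ v ∈ S ∧ ∀ i, v i ≤ c := by
  simp [box]

/-- The number of `r`-dimensional cones in the decomposition of `S` into the cones
`cone v (topFace c v)`, where `v` runs through `box S c`. -/
def coneCount (S : Set (σ →₀ ℕ)) (c r : ℕ) : ℕ := #{v ∈ box S c | #(topFace c v) = r}

lemma mem_cone_topFace_iff {v : σ →₀ ℕ} (hv : ∀ i, v i ≤ c) {u : σ →₀ ℕ} :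
    u ∈ cone v (topFace c v) ↔ trunc c u = v := by
  constructor
  · rintro ⟨hvu, hu⟩
    ext i
    by_cases hi : v i = c
    · rw [trunc_apply, min_eq_right (hi ▸ hvu i), hi]
    · rw [trunc_apply, hu i (by simpa using hi), min_eq_left (hv i)]
  · rintro rfl
    refine ⟨trunc_le c u, fun i hi => ?_⟩
    simp only [mem_topFace, trunc_apply] at hi ⊢
    omega

lemma ncard_inter_eq_sum_cone (hc : IsTruncStable S c) {A : Set (σ →₀ ℕ)}
    (hA : A.Finite) : (S ∩ A).ncard = ∑ v ∈ box S c, (cone v (topFace c v) ∩ A).ncard := by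
  classical
  have hmaps : ∀ u ∈ (hA.inter_of_right S).toFinset, trunc c u ∈ box S c := fun u hu => by
    rw [Set.Finite.mem_toFinset] at hu
    exact mem_box.2 ⟨(hc u).1 hu.1, fun i => by simp⟩
  rw [Set.ncard_eq_toFinset_card _ (hA.inter_of_right S), card_eq_sum_card_fiberwise hmaps]
  refine sum_congr rfl fun v hv => ?_
  rw [mem_box] at hv
  rw [← Set.ncard_coe_finset]
  congr 1
  ext u
  simp only [coe_filter, Set.Finite.mem_toFinset, Set.mem_inter_iff, Set.mem_ofPred_eq,
    mem_cone_topFace_iff hv.2, and_assoc, and_comm (b := trunc c u = v)]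
  rw [and_left_comm, and_congr_right_iff]
  rintro rfl
  exact and_iff_right ((hc u).2 hv.1)

lemma levelCard_eq_sum_cone (hc : IsTruncStable S c) (m : ℕ) :
    levelCard S m = ∑ v ∈ box S c, levelCard (cone v (topFace c v)) m :=
  ncard_inter_eq_sum_cone hc (Finsupp.finite_of_degree_eq m)

lemma cone_base_subset (hS : IsLowerSet S) (hc : IsTruncStable S c) {v : σ →₀ ℕ}
    (hv : v ∈ S) : cone (base c v) (topFace c v) ⊆ S := by
  rintro u ⟨-, hu⟩
  refine (hc u).2 (hS (fun i => ?_) hv)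
  have hui := hu i
  rw [mem_topFace, base_apply] at hui
  rw [trunc_apply]
  split_ifs at hui <;> omega

lemma exists_mem_box_of_le_base (hS : IsLowerSet S) {v b : σ →₀ ℕ} (hv : v ∈ box S c)
    (hb : b ≤ base c v) : ∃ w ∈ box S c, base c w = b ∧ topFace c w = topFace c v := by
  rw [mem_box] at hv
  have hb' : ∀ i, v i = c ∧ b i = 0 ∨ v i < c ∧ b i ≤ v i := fun i => by
    have hbi := hb i
    have hvi := hv.2 i
    rw [base_apply] at hbi
    split_ifs at hbi <;> omega
  let w := b + (v - base c v)
  have hw : ∀ i, w i = if v i = c then c else b i := fun i => by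
    have := hb' i
    simp only [w, Finsupp.add_apply, Finsupp.tsub_apply, base_apply]
    split_ifs <;> omega
  have hwv : w ≤ v := fun i => by
    have := hb' i
    rw [hw]
    split_ifs <;> omega
  refine ⟨w, mem_box.2 ⟨hS hwv hv.1, fun i => (hwv i).trans (hv.2 i)⟩, ?_, ?_⟩
  · ext i
    have := hb' i
    rw [base_apply, hw]
    split_ifs <;> omega
  · ext i
    have := hb' i
    rw [mem_topFace, mem_topFace, hw]
    split_ifs <;> omega

lemma base_topFace_injective : Function.Injective fun v : σ →₀ ℕ => (base c v, topFace c v) := by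
  intro v w hvw
  rw [Prod.mk.injEq] at hvw
  ext i
  have hbase := DFunLike.congr_fun hvw.1 i
  have hface : v i = c ↔ w i = c := by
    simpa only [mem_topFace] using Finset.ext_iff.1 hvw.2 i
  rw [base_apply, base_apply] at hbase
  split_ifs at hbase <;> omega

lemma sum_range_binom_le_levelCard (hS : IsLowerSet S) (hc : IsTruncStable S c) (D m : ℕ) :
    ∑ j ∈ range (coneCount S c (D + 1)), binom (m + D - j) D ≤ levelCard S m := by
  classical
  let s := {v ∈ box S c | #(topFace c v) = D + 1}.image fun v => (base c v, topFace c v)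
  have mem_s : ∀ p, p ∈ s ↔
      ∃ v ∈ box S c, #(topFace c v) = D + 1 ∧ base c v = p.1 ∧ topFace c v = p.2 := fun p => by
    simp [s, Prod.ext_iff, and_assoc]
  rw [coneCount, ← card_image_of_injective _ (base_topFace_injective (c := c))]
  refine (sum_range_binom_le_levelCard_iUnion_cone s ?_ ?_ ?_ m).trans
    (mod_cast levelCard_mono (Set.iUnion₂_subset ?_) m)
  · intro p hp
    obtain ⟨v, -, hD, -, hface⟩ := (mem_s p).1 hp
    rwa [← hface]
  · intro p hp i hi
    obtain ⟨v, -, -, hbase, hface⟩ := (mem_s p).1 hp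
    rw [← hface, mem_topFace] at hi
    rw [← hbase, base_apply, if_pos hi]
  · intro Z a b hba ha
    obtain ⟨v, hv, hD, hbase, hface⟩ := (mem_s (a, Z)).1 ha
    obtain ⟨w, hw, hbase', hface'⟩ := exists_mem_box_of_le_base hS hv (hba.trans_eq hbase.symm)
    exact (mem_s (b, Z)).2 ⟨w, hw, hface' ▸ hD, hbase', hface'.trans hface⟩
  · intro p hp
    obtain ⟨v, hv, -, hbase, hface⟩ := (mem_s p).1 hp
    rw [← hbase, ← hface]
    exact cone_base_subset hS hc (mem_box.1 hv).1

lemma binom_sub_binom_le_levelCard (hS : IsLowerSet S) (hc : IsTruncStable S c) (D m : ℕ) :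
    binom (m + D + 1) (D + 1) - binom (m - coneCount S c (D + 1) + D + 1) (D + 1) ≤
      levelCard S m := by
  have hshift : (m : ℤ) - coneCount S c (D + 1) + D + 1 = m + D + 1 - coneCount S c (D + 1) := by
    ring
  rw [hshift, ← sum_range_binom]
  exact sum_range_binom_le_levelCard hS hc D m

end StanleyDecomposition

noncomputable section ConePolynomial

variable {σ : Type*} {D : ℕ}

/-- The polynomial giving the number of elements of large degree in the cone `g + ℕ^Z`. The empty
set of directions is treated separately because of the truncated subtraction `#Z - 1`. -/
def coneHilbertPoly (g : σ →₀ ℕ) (Z : Finset σ) : ℚ[X] :=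
  open Classical in if Z = ∅ then 0 else preHilbertPoly ℚ (#Z - 1) g.degree

lemma coneHilbertPoly_of_card_eq_succ (g : σ →₀ ℕ) {Z : Finset σ} (hZ : #Z = D + 1) :
    coneHilbertPoly g Z = preHilbertPoly ℚ D g.degree := by
  have hne : Z ≠ ∅ := by rintro rfl; simp at hZ
  rw [coneHilbertPoly, if_neg hne, hZ, Nat.add_sub_cancel]

lemma eval_coneHilbertPoly {g : σ →₀ ℕ} (Z : Finset σ) {m : ℕ} (hm : g.degree < m) :
    (coneHilbertPoly g Z).eval (m : ℚ) = levelCard (cone g Z) m := by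
  obtain rfl | hne := Z.eq_empty_or_nonempty
  · rw [levelCard_cone_empty hm, coneHilbertPoly, if_pos rfl, eval_zero, Nat.cast_zero]
  · obtain ⟨r, rfl⟩ := Nat.exists_eq_add_of_le hm.le
    obtain ⟨D, hD⟩ := Nat.exists_eq_add_one.2 hne.card_pos
    rw [coneHilbertPoly_of_card_eq_succ g hD, preHilbertPoly_eq_choose_sub_add _ _ hm.le,
      levelCard_cone_degree_add, hD, Nat.add_sub_cancel_left, add_right_comm, Nat.add_sub_cancel,
      add_comm r, Nat.choose_symm_add]

lemma natDegree_coneHilbertPoly_le (g : σ →₀ ℕ) (Z : Finset σ) :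
    (coneHilbertPoly g Z).natDegree ≤ #Z - 1 := by
  unfold coneHilbertPoly
  split_ifs
  · simp
  · rw [natDegree_preHilbertPoly]

lemma coeff_coneHilbertPoly (g : σ →₀ ℕ) {Z : Finset σ} (hZ : #Z ≤ D + 1) :
    (coneHilbertPoly g Z).coeff D = if #Z = D + 1 then (D.factorial : ℚ)⁻¹ else 0 := by
  split_ifs with h
  · rw [coneHilbertPoly_of_card_eq_succ g h, coeff_preHilbertPoly_self]
  · obtain rfl | hne := Z.eq_empty_or_nonempty
    · rw [coneHilbertPoly, if_pos rfl, coeff_zero]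
    · have hpos := hne.card_pos
      exact coeff_eq_zero_of_natDegree_lt
        ((natDegree_coneHilbertPoly_le g Z).trans_lt (by omega))

variable [Fintype σ] {S : Set (σ →₀ ℕ)} {c : ℕ}

/-- The polynomial giving the number of elements of large degree in `S`, provided that membership
in `S` is detected by truncation at `c`. -/
def levelPoly (S : Set (σ →₀ ℕ)) (c : ℕ) : ℚ[X] :=
  ∑ v ∈ box S c, coneHilbertPoly v (topFace c v)

lemma eventually_levelCard_eq_eval_levelPoly (hc : IsTruncStable S c) :
    ∃ m₀, ∀ m : ℕ, m₀ ≤ m → (levelCard S m : ℚ) = (levelPoly S c).eval (m : ℚ) := by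
  refine ⟨(box S c).sup Finsupp.degree + 1, fun m hm => ?_⟩
  rw [levelCard_eq_sum_cone hc, levelPoly, eval_finsetSum, Nat.cast_sum]
  exact sum_congr rfl fun v hv =>
    (eval_coneHilbertPoly _ ((le_sup (f := Finsupp.degree) hv).trans_lt hm)).symm

lemma coeff_levelPoly (hD : ∀ v ∈ box S c, #(topFace c v) ≤ D + 1) :
    (levelPoly S c).coeff D =
      coneCount S c (D + 1) * (D.factorial : ℚ)⁻¹ := by
  rw [levelPoly, finsetSum_coeff, sum_congr rfl fun v hv => coeff_coneHilbertPoly v (hD v hv),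
    ← sum_filter, sum_const, nsmul_eq_mul, coneCount]

lemma natDegree_levelPoly_le (hD : ∀ v ∈ box S c, #(topFace c v) ≤ D + 1) :
    (levelPoly S c).natDegree ≤ D :=
  natDegree_sum_le_of_forall_le _ _ fun v hv =>
    (natDegree_coneHilbertPoly_le v _).trans (by have := hD v hv; omega)

end ConePolynomial

section StandardMonomials

variable {k σ : Type*} [Field k] {o : MonomialOrder σ} {I : Ideal (MvPolynomial σ k)}

/-- The exponents of the standard monomials of `I`, i.e. of those that are not divisible by the
leading monomial of a nonzero element of `I`. -/
def standardExponents (o : MonomialOrder σ) (I : Ideal (MvPolynomial σ k)) : Set (σ →₀ ℕ) :=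
  {u | ∀ f ∈ I, f ≠ 0 → ¬ o.degree f ≤ u}

lemma isLowerSet_standardExponents (o : MonomialOrder σ) (I : Ideal (MvPolynomial σ k)) :
    IsLowerSet (standardExponents o I) :=
  fun _ _ hvu hu f hf hf0 hfv => hu f hf hf0 (hfv.trans hvu)

lemma eq_zero_of_mem_restrictSupport_standardExponents {f : MvPolynomial σ k} (hf : f ∈ I)
    (h : f ∈ MvPolynomial.restrictSupport k (standardExponents o I)) : f = 0 := by
  by_contra hf0
  exact MvPolynomial.mem_restrictSupport_iff k |>.1 h (o.degree_mem_support hf0) f hf hf0 le_rfl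

lemma exists_sub_mem_of_standardExponents (o : MonomialOrder σ) (I : Ideal (MvPolynomial σ k))
    (f : MvPolynomial σ k) :
    ∃ r ∈ MvPolynomial.restrictSupport k (standardExponents o I), f - r ∈ I := by
  have hunit : ∀ b ∈ {b | b ∈ I ∧ b ≠ 0}, IsUnit (o.leadingCoeff b) := fun b hb =>
    (o.leadingCoeff_ne_zero_iff.2 hb.2).isUnit
  obtain ⟨g, r, hfr, -, hr⟩ := o.div_set hunit f
  refine ⟨r, MvPolynomial.mem_restrictSupport_iff k |>.2
    fun u hu b hb hb0 => hr u hu b ⟨hb, hb0⟩, ?_⟩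
  rw [hfr, add_sub_cancel_right, Finsupp.linearCombination_apply]
  exact I.sum_mem fun b _ => I.mul_mem_left _ b.2.1

lemma map_restrictSupport_degree_preimage
    (hI : I.IsHomogeneous (MvPolynomial.homogeneousSubmodule σ k)) (o : MonomialOrder σ)
    (T : Set ℕ) :
    (MvPolynomial.restrictSupport k (Finsupp.degree ⁻¹' T)).map
        (Ideal.Quotient.mkₐ k I).toLinearMap =
      (MvPolynomial.restrictSupport k (standardExponents o I ∩ Finsupp.degree ⁻¹' T)).map
        (Ideal.Quotient.mkₐ k I).toLinearMap := by
  refine le_antisymm ?_ (Submodule.map_mono (MvPolynomial.restrictSupport_mono k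
    Set.inter_subset_right))
  rw [MvPolynomial.restrictSupport_eq_span, Submodule.map_span_le]
  rintro _ ⟨u, hu, rfl⟩
  obtain ⟨r, hr, hru⟩ := exists_sub_mem_of_standardExponents o I (MvPolynomial.monomial u 1)
  -- As `I` is homogeneous, the component of `r` of the degree of `u` is congruent to `x ^ u`.
  have hcomp := MvPolynomial.homogeneousComponent_mem_of_mem hI hru u.degree
  rw [map_sub, MvPolynomial.homogeneousComponent_of_mem
    (MvPolynomial.isHomogeneous_monomial 1 rfl), if_pos rfl] at hcomp
  refine ⟨MvPolynomial.homogeneousComponent u.degree r, ?_, (Ideal.Quotient.eq.2 hcomp).symm⟩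
  refine MvPolynomial.mem_restrictSupport_iff k |>.2 fun v hv => ?_
  rw [MvPolynomial.support_homogeneousComponent, coe_filter] at hv
  exact ⟨MvPolynomial.mem_restrictSupport_iff k |>.1 hr hv.1, by simpa [hv.2] using hu⟩

lemma finrank_restrictSupport (U : Set (σ →₀ ℕ)) :
    Module.finrank k (MvPolynomial.restrictSupport k U) = U.ncard :=
  Module.finrank_eq_nat_card_basis (MvPolynomial.basisRestrictSupport k U)

lemma finrank_map_restrictSupport_degree_preimage
    (hI : I.IsHomogeneous (MvPolynomial.homogeneousSubmodule σ k)) (o : MonomialOrder σ)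
    (T : Set ℕ) :
    Module.finrank k ((MvPolynomial.restrictSupport k (Finsupp.degree ⁻¹' T)).map
        (Ideal.Quotient.mkₐ k I).toLinearMap) =
      (standardExponents o I ∩ Finsupp.degree ⁻¹' T).ncard := by
  rw [map_restrictSupport_degree_preimage hI o, ← LinearMap.range_domRestrict,
    LinearMap.finrank_range_of_inj, finrank_restrictSupport]
  refine LinearMap.ker_eq_bot.1 (LinearMap.ker_eq_bot'.2 fun f hf => Subtype.ext ?_)
  exact eq_zero_of_mem_restrictSupport_standardExponents (o := o)
    (Ideal.Quotient.eq_zero_iff_mem.1 hf)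
    (MvPolynomial.restrictSupport_mono k Set.inter_subset_left f.2)

lemma hilbertFunction_eq_levelCard {n : ℕ} {I : Ideal (MvPolynomial (Fin (n + 1)) k)}
    (hI : I.IsHomogeneous (MvPolynomial.homogeneousSubmodule (Fin (n + 1)) k))
    (o : MonomialOrder (Fin (n + 1))) (m : ℕ) :
    hilbertFunction I m = levelCard (standardExponents o I) m := by
  rw [hilbertFunction, MvPolynomial.homogeneousSubmodule_eq_finsupp_supported]
  exact finrank_map_restrictSupport_degree_preimage hI o {m}

end StandardMonomials

section KrullDimension

lemma ringKrullDim_eq_of_isIntegral {R S : Type*} [CommRing R] [CommRing S] [Algebra R S]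
    [Algebra.IsIntegral R S] (h : Function.Injective (algebraMap R S)) :
    ringKrullDim S = ringKrullDim R := by
  refine le_antisymm ?_ (iSup_le fun l => ?_)
  · refine Order.krullDim_le_of_strictMono (PrimeSpectrum.comap (algebraMap R S)) fun P Q hPQ => ?_
    exact Ideal.IsIntegral.comap_lt_comap (R := R) hPQ
  · obtain ⟨P, -, hP, hPl⟩ := Ideal.exists_ideal_over_prime_of_isIntegral l.head.asIdeal
      (⊥ : Ideal S) (by rw [Ideal.comap_bot_of_injective _ h]; exact bot_le)
    have : P.LiesOver l.head.asIdeal := ⟨hPl.symm⟩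
    obtain ⟨L, hL, -⟩ := Ideal.exists_ltSeries_of_hasGoingUp l P
    rw [← hL]
    exact le_iSup (fun L : LTSeries (PrimeSpectrum S) => (L.length : WithBot ℕ∞)) L

variable {k A : Type*} [Field k] [CommRing A] [Algebra k A] {r : ℕ}

lemma ringKrullDim_eq_of_finite_of_injective {g : MvPolynomial (Fin r) k →ₐ[k] A}
    (hg : Function.Injective g) (hfin : g.Finite) : ringKrullDim A = r := by
  algebraize [g.toRingHom]
  have : Module.Finite (MvPolynomial (Fin r) k) A := hfin
  rw [ringKrullDim_eq_of_isIntegral (R := MvPolynomial (Fin r) k) hg,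
    MvPolynomial.ringKrullDim_of_isNoetherianRing, ringKrullDim_eq_zero_of_field, zero_add,
    Nat.card_fin]

lemma trdeg_eq_of_finite_of_injective [IsDomain A] {g : MvPolynomial (Fin r) k →ₐ[k] A}
    (hg : Function.Injective g) (hfin : g.Finite) : Algebra.trdeg k A = r := by
  algebraize [g.toRingHom]
  have : Module.Finite (MvPolynomial (Fin r) k) A := hfin
  have : IsScalarTower k (MvPolynomial (Fin r) k) A := .of_algebraMap_eq' g.comp_algebraMap.symm
  have : FaithfulSMul (MvPolynomial (Fin r) k) A := (faithfulSMul_iff_algebraMap_injective _ _).2 hg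
  have h := lift_trdeg_add_eq k (MvPolynomial (Fin r) k) A
  rw [MvPolynomial.trdeg_of_isDomain, trdeg_eq_zero (R := MvPolynomial (Fin r) k)] at h
  simpa using h.symm

variable [Algebra.FiniteType k A] {ι : Type*} [Finite ι]

lemma natCard_le_ringKrullDim {x : ι → A} (hx : AlgebraicIndependent k x) :
    (Nat.card ι : WithBot ℕ∞) ≤ ringKrullDim A := by
  -- Pass to a quotient domain of `A` in which `x` remains algebraically independent.
  obtain ⟨P, hP, hPx⟩ := Ideal.exists_comap_eq_of_mem_minimalPrimes_of_injective
    (f := (MvPolynomial.aeval x).toRingHom) hx ⊥ (by simp [IsDomain.minimalPrimes_eq_singleton_bot])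
  have hxP : AlgebraicIndependent k (Ideal.Quotient.mkₐ k P ∘ x) := by
    refine algebraicIndependent_iff.2 fun p hp => ?_
    have hpx : Ideal.Quotient.mkₐ k P (MvPolynomial.aeval x p) = 0 := by
      rwa [MvPolynomial.comp_aeval_apply]
    exact hPx.le (Ideal.mem_comap.2 (Ideal.Quotient.eq_zero_iff_mem.1 hpx))
  obtain ⟨s, g, hg, hfin⟩ := exists_finite_inj_algHom_of_fg k (A ⧸ P)
  have hle := hxP.lift_cardinalMk_le_trdeg
  rw [trdeg_eq_of_finite_of_injective hg hfin, ← Nat.cast_card] at hle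
  refine le_trans ?_ (ringKrullDim_quotient_le P)
  rw [ringKrullDim_eq_of_finite_of_injective hg hfin]
  simpa using hle

lemma exists_algebraicIndependent_of_ringKrullDim_eq (hr : ringKrullDim A = r) :
    ∃ x : Fin r → A, AlgebraicIndependent k x := by
  have : Nontrivial A := by
    by_contra hA
    rw [not_nontrivial_iff_subsingleton] at hA
    exact WithBot.bot_ne_coe (ringKrullDim_eq_bot_of_subsingleton.symm.trans hr)
  obtain ⟨s, g, hg, hfin⟩ := exists_finite_inj_algHom_of_fg k A
  obtain rfl : r = s := by
    exact_mod_cast hr.symm.trans (ringKrullDim_eq_of_finite_of_injective hg hfin)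
  exact ⟨g ∘ MvPolynomial.X, by rwa [AlgebraicIndependent, ← MvPolynomial.aeval_unique]⟩

end KrullDimension

section Growth

variable {σ : Type*}

lemma ncard_setOf_forall_le [Finite σ] (N : ℕ) :
    {u : σ →₀ ℕ | ∀ i, u i ≤ N}.ncard = (N + 1) ^ Nat.card σ := by
  have := Fintype.ofFinite σ
  let e : {u : σ →₀ ℕ | ∀ i, u i ≤ N} ≃ (σ → Set.Iic N) :=
    (Finsupp.equivFunOnFinite.subtypeEquiv fun _ => Iff.rfl).trans
      (Equiv.subtypePiEquivPi (p := fun _ x => x ≤ N))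
  rw [← Nat.card_coe_set_eq, Nat.card_congr e, Nat.card_pi, prod_const, Nat.card_coe_set_eq,
    Set.ncard_Iic_nat, card_univ, Nat.card_eq_fintype_card]

lemma exists_pow_le_finrank [Finite σ] {k A ι : Type*} [Field k] [CommRing A] [Algebra k A]
    [Finite ι] {φ : MvPolynomial σ k →ₐ[k] A} (hφ : Function.Surjective φ)
    {x : ι → A} (hx : AlgebraicIndependent k x) :
    ∃ a, ∀ t, (t + 1) ^ Nat.card ι ≤
      Module.finrank k ((MvPolynomial.restrictTotalDegree σ k (a * t)).map φ.toLinearMap) := by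
  have := Fintype.ofFinite ι
  choose q hq using fun i => hφ (x i)
  refine ⟨∑ i, (q i).totalDegree, fun t => ?_⟩
  rw [← ncard_setOf_forall_le, ← finrank_restrictSupport (k := k),
    (Submodule.equivMapOfInjective (MvPolynomial.aeval x).toLinearMap hx _).finrank_eq]
  refine Submodule.finrank_mono ?_
  rw [MvPolynomial.restrictSupport_eq_span, Submodule.map_span_le]
  rintro _ ⟨u, hu, rfl⟩
  refine Submodule.mem_map.2 ⟨∏ i, q i ^ u i, ?_, ?_⟩
  · rw [MvPolynomial.mem_restrictTotalDegree, sum_mul]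
    refine (MvPolynomial.totalDegree_finsetProd _ _).trans (sum_le_sum fun i _ => ?_)
    refine (MvPolynomial.totalDegree_pow _ _).trans ?_
    rw [mul_comm]
    exact Nat.mul_le_mul_left _ (hu i)
  · simp [MvPolynomial.aeval_monomial, Finsupp.prod_fintype, hq]

lemma ncard_cone_inter_degree_le (g : σ →₀ ℕ) (Z : Finset σ) (M : ℕ) :
    (cone g Z ∩ Finsupp.degree ⁻¹' Set.Iic M).ncard ≤ (M + 1) ^ #Z := by
  let f : ↥(cone g Z ∩ Finsupp.degree ⁻¹' Set.Iic M) → (Z → Fin (M + 1)) := fun u i =>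
    ⟨u.1 i, Nat.lt_succ_of_le ((Finsupp.le_degree _ _).trans u.2.2)⟩
  have hf : Function.Injective f := by
    intro u v huv
    refine Subtype.ext (Finsupp.ext fun i => ?_)
    by_cases hi : i ∈ Z
    · exact congrArg Fin.val (congrFun huv ⟨i, hi⟩)
    · rw [u.2.1.2 i hi, v.2.1.2 i hi]
  simpa [Nat.card_fun] using Nat.card_le_card_of_injective f hf

lemma le_of_forall_pow_le_mul_pow {a b K : ℕ} (h : ∀ t : ℕ, (t + 1) ^ a ≤ K * (t + 1) ^ b) :
    a ≤ b := by
  by_contra! hab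
  have hlt : K * (K + 1) ^ b < (K + 1) ^ (b + 1) := by
    rw [pow_succ']
    exact Nat.mul_lt_mul_of_pos_right (by omega) (by positivity)
  exact (hlt.trans_le (Nat.pow_le_pow_right (by omega) hab)).not_ge (h K)

lemma ncard_inter_degree_le_mul_pow [Fintype σ] {S : Set (σ →₀ ℕ)} {c : ℕ}
    (hc : IsTruncStable S c) {b : ℕ} (hb : ∀ v ∈ box S c, #(topFace c v) ≤ b) (M : ℕ) :
    (S ∩ Finsupp.degree ⁻¹' Set.Iic M).ncard ≤ #(box S c) * (M + 1) ^ b := by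
  have hfin : (Finsupp.degree ⁻¹' Set.Iic M : Set (σ →₀ ℕ)).Finite :=
    Finsupp.finite_of_degree_le M
  rw [ncard_inter_eq_sum_cone hc hfin]
  exact sum_le_card_nsmul _ _ _ fun v hv =>
    (ncard_cone_inter_degree_le _ _ _).trans (Nat.pow_le_pow_right M.succ_pos (hb v hv))

end Growth

section KrullDimensionOfStandardMonomials

variable {k σ : Type*} [Field k] {o : MonomialOrder σ} {I : Ideal (MvPolynomial σ k)}

lemma algebraicIndependent_X_of_cone_subset {g : σ →₀ ℕ} {Z : Finset σ}
    (h : cone g Z ⊆ standardExponents o I) :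
    AlgebraicIndependent k fun i : Z => Ideal.Quotient.mkₐ k I (MvPolynomial.X (i : σ)) := by
  classical
  refine algebraicIndependent_iff.2 fun p hp => ?_
  have hrename : Ideal.Quotient.mkₐ k I (MvPolynomial.rename Subtype.val p) = 0 := by
    rw [← hp, MvPolynomial.rename_eq_aeval, MvPolynomial.comp_aeval_apply]
    rfl
  refine MvPolynomial.rename_injective _ Subtype.val_injective ?_
  rw [map_zero]
  refine eq_zero_of_mem_restrictSupport_standardExponents (o := o)
    (Ideal.Quotient.eq_zero_iff_mem.1 hrename) (MvPolynomial.mem_restrictSupport_iff k |>.2 ?_)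
  intro u hu
  rw [MvPolynomial.support_rename_of_injective Subtype.val_injective, mem_coe, mem_image] at hu
  obtain ⟨w, -, rfl⟩ := hu
  refine isLowerSet_standardExponents o I le_add_self
    (h (mem_cone_iff_exists_add.2 ⟨_, fun i hi => ?_, rfl⟩))
  obtain ⟨j, -, rfl⟩ := mem_image.1 (Finsupp.mapDomain_support hi)
  exact j.2

lemma card_le_ringKrullDim_of_cone_subset [Finite σ] {g : σ →₀ ℕ} {Z : Finset σ}
    (h : cone g Z ⊆ standardExponents o I) :
    (#Z : WithBot ℕ∞) ≤ ringKrullDim (MvPolynomial σ k ⧸ I) := by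
  simpa using natCard_le_ringKrullDim (algebraicIndependent_X_of_cone_subset h)

variable [Fintype σ] {c : ℕ}

lemma card_topFace_le_of_ringKrullDim_eq {r : ℕ} (hr : ringKrullDim (MvPolynomial σ k ⧸ I) = r)
    (hc : IsTruncStable (standardExponents o I) c) {v : σ →₀ ℕ}
    (hv : v ∈ box (standardExponents o I) c) : #(topFace c v) ≤ r := by
  have h := card_le_ringKrullDim_of_cone_subset
    (cone_base_subset (isLowerSet_standardExponents o I) hc (mem_box.1 hv).1)
  rw [hr] at h
  exact_mod_cast h

lemma le_of_forall_card_topFace_le (hI : I.IsHomogeneous (MvPolynomial.homogeneousSubmodule σ k))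
    {r b : ℕ} (hr : ringKrullDim (MvPolynomial σ k ⧸ I) = r)
    (hc : IsTruncStable (standardExponents o I) c)
    (hb : ∀ v ∈ box (standardExponents o I) c, #(topFace c v) ≤ b) : r ≤ b := by
  obtain ⟨x, hx⟩ := exists_algebraicIndependent_of_ringKrullDim_eq (k := k) hr
  obtain ⟨a, ha⟩ := exists_pow_le_finrank (Ideal.Quotient.mkₐ_surjective k I) hx
  simp only [Nat.card_fin] at ha
  refine le_of_forall_pow_le_mul_pow (K := #(box (standardExponents o I) c) * (a + 1) ^ b)
    fun t => (ha t).trans ?_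
  calc Module.finrank k ((MvPolynomial.restrictTotalDegree σ k (a * t)).map _)
    _ = (standardExponents o I ∩ Finsupp.degree ⁻¹' Set.Iic (a * t)).ncard :=
      finrank_map_restrictSupport_degree_preimage hI o (Set.Iic (a * t))
    _ ≤ #(box (standardExponents o I) c) * (a * t + 1) ^ b :=
      ncard_inter_degree_le_mul_pow hc hb _
    _ ≤ #(box (standardExponents o I) c) * (a + 1) ^ b * (t + 1) ^ b := by
      rw [mul_assoc, ← mul_pow]
      gcongr
      nlinarith

end KrullDimensionOfStandardMonomials

section HilbertPolynomial

variable {k : Type*} [Field k] {n : ℕ} {I : Ideal (MvPolynomial (Fin (n + 1)) k)}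

lemma IsHilbertPolynomial.unique {p q : ℚ[X]} (hp : IsHilbertPolynomial I p)
    (hq : IsHilbertPolynomial I q) : p = q := by
  obtain ⟨a, ha⟩ := hp
  obtain ⟨b, hb⟩ := hq
  refine eq_of_infinite_eval_eq p q
    (((Set.Ici_infinite (max a b)).image Nat.cast_injective.injOn).mono ?_)
  rintro _ ⟨m, hm, rfl⟩
  exact (ha m (le_of_max_le_left hm)).symm.trans (hb m (le_of_max_le_right hm))

lemma IsHilbertPolynomial.hilbertPolynomial_eq {p : ℚ[X]} (hp : IsHilbertPolynomial I p) :
    hilbertPolynomial I = p := by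
  have h : ∃ p, IsHilbertPolynomial I p := ⟨p, hp⟩
  rw [hilbertPolynomial, dif_pos h]
  exact h.choose_spec.unique hp

variable {o : MonomialOrder (Fin (n + 1))} {c d : ℕ}

lemma isHilbertPolynomial_levelPoly
    (hI : I.IsHomogeneous (MvPolynomial.homogeneousSubmodule (Fin (n + 1)) k))
    (hc : IsTruncStable (standardExponents o I) c) :
    IsHilbertPolynomial I (levelPoly (standardExponents o I) c) := by
  simpa only [IsHilbertPolynomial, hilbertFunction_eq_levelCard hI o] using
    eventually_levelCard_eq_eval_levelPoly hc

lemma HasProjDim.card_topFace_le (hd : HasProjDim I d)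
    (hc : IsTruncStable (standardExponents o I) c) :
    ∀ v ∈ box (standardExponents o I) c, #(topFace c v) ≤ d + 1 :=
  fun _ hv => card_topFace_le_of_ringKrullDim_eq (mod_cast hd) hc hv

lemma HasProjDim.exists_card_topFace_eq (hd : HasProjDim I d)
    (hI : I.IsHomogeneous (MvPolynomial.homogeneousSubmodule (Fin (n + 1)) k))
    (hc : IsTruncStable (standardExponents o I) c) :
    ∃ v ∈ box (standardExponents o I) c, #(topFace c v) = d + 1 := by
  by_contra! h
  have hle : d + 1 ≤ d := le_of_forall_card_topFace_le hI (mod_cast hd) hc fun v hv =>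
    Nat.le_of_lt_succ ((hd.card_topFace_le hc v hv).lt_of_ne (h v hv))
  omega

lemma degree_levelPoly (hd : HasProjDim I d)
    (hI : I.IsHomogeneous (MvPolynomial.homogeneousSubmodule (Fin (n + 1)) k))
    (hc : IsTruncStable (standardExponents o I) c) :
    (levelPoly (standardExponents o I) c).degree = d := by
  obtain ⟨v, hv, hvd⟩ := hd.exists_card_topFace_eq hI hc
  have hle := hd.card_topFace_le hc
  refine degree_eq_of_le_of_coeff_ne_zero
    (natDegree_le_iff_degree_le.1 (natDegree_levelPoly_le hle)) ?_
  rw [coeff_levelPoly hle]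
  have hcount : coneCount (standardExponents o I) c (d + 1) ≠ 0 :=
    card_ne_zero_of_mem (mem_filter.2 ⟨hv, hvd⟩)
  positivity

end HilbertPolynomial

end HilbertBound

open HilbertBound in
theorem theorem2p3 {k : Type*} [Field k] (n d : ℕ)
    (I : Ideal (MvPolynomial (Fin (n + 1)) k))
    (hI : I.IsHomogeneous (MvPolynomial.homogeneousSubmodule (Fin (n + 1)) k))
    (hd : HilbertBound.HasProjDim I d) :
    HilbertBound.IsHilbertPolynomial I (HilbertBound.hilbertPolynomial I) ∧
    (HilbertBound.hilbertPolynomial I).degree = (d : WithBot ℕ) ∧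
    ∃ δ : ℕ, HilbertBound.idealDegree I d = (δ : ℚ) ∧
      ∀ m : ℕ, 1 ≤ m →
        HilbertBound.binom ((m : ℤ) + d + 1) (d + 1)
            - HilbertBound.binom ((m : ℤ) - δ + d + 1) (d + 1)
          ≤ (HilbertBound.hilbertFunction I m : ℤ) := by
  let o : MonomialOrder (Fin (n + 1)) := MonomialOrder.lex
  have hS := isLowerSet_standardExponents o I
  obtain ⟨c, hc⟩ := exists_isTruncStable hS
  have hp := isHilbertPolynomial_levelPoly hI hc
  rw [idealDegree, hp.hilbertPolynomial_eq]
  refine ⟨hp, degree_levelPoly hd hI hc, coneCount (standardExponents o I) c (d + 1), ?_,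
    fun m _ => ?_⟩
  · rw [coeff_levelPoly (hd.card_topFace_le hc)]
    field_simp
  · rw [hilbertFunction_eq_levelCard hI o]
    exact binom_sub_binom_le_levelCard hS hc d m
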